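/- Let $S$ be the set of 27 variables $E_i$ ($1\le i\le 6$), $F_{ij}=F_{ji}$ ($1\le i<j\le 6$), $G_i$ ($1\le i\le 6$). The Weyl group $W(E_6)$ acts simultaneously on the parameter space $\mathbb{C}^6$ with coordinates $d_1,\dots,d_6$ and on $S$ by permutations; it is generated by the following six simple reflections: the transpositions $(i\ i{+}1)$, $1\le i\le 5$, permuting the indices of the $d$'s, $E$'s, $F$'s and $G$'s; and the reflection in $d_1+d_2+d_3$, namely $d_i\mapsto d_i-\tfrac23(d_1+d_2+d_3)$ for $i\le 3$ and $d_i\mapsto d_i+\tfrac13(d_1+d_2+d_3)$ for $i\ge 4$, together with the exchange $E_1\leftrightarrow F_{23}$, $E_2\leftrightarrow F_{13}$, $E_3\leftrightarrow F_{12}$, $G_4\leftrightarrow F_{56}$, $G_5\leftrightarrow F_{46}$, $G_6\leftrightarrow F_{45}$ (the other 15 variables being fixed). For $d\in\mathbb{C}^6$ let $\mathcal{T}_d\subset\mathbb{C}[S]$ be the set of the ten trinomials $$(d_k-d_l)(d_1+d_k+d_l)E_jF_{1j}-(d_j-d_l)(d_1+d_j+d_l)E_kF_{1k}+(d_j-d_k)(d_1+d_j+d_k)E_lF_{1l},\qquad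 2\le j<k<l\le 6,$$ and all their translates under $W(E_6)$ (270 trinomials up to sign). Let $I_X\subset\mathbb{C}[S]$ be the saturation of the ideal $\langle\mathcal{T}_d\rangle$ at the product of all 27 variables; this is the Cox ideal of the blow-up $X$ of $\mathbb{P}^2_{\mathbb{C}}$ in the six points $(1:d_i:d_i^3)$. With respect to the trivial valuation on $\mathbb{C}$ and $w\in\mathbb{R}^S$, let $\mathrm{in}_w(f)$ be the sum of the terms of $f$ of minimal $w$-weight, and let $\mathrm{in}_w(I)$ be the ideal generated by all $\mathrm{in}_w(f)$, $f\in I$. For a set or an ideal $A$ of Laurent polynomials let $\mathrm{Trop}(A)$ be the set of all $w\in\mathbb{R}^S$ such that $\mathrm{in}_w(f)$ is not a monomial for all $f\in A$. A set $A$ is a tropical basis of an ideal $J$ if it generates $J$ and $\mathrm{Trop}(A)=\mathrm{Trop}(J)$. Theorem. For generic $d=(d_1,\dots,d_6)\in\mathbb{C}^6$, that is, for all $d$ outside the zero set of some nonzero polynomial, the trinomials $\mathcal{T}_d$ generate the ideal $J:=I_X\,\mathbb{C}[x^{\pm1}\mid x\in S]$ of the Laurent polynomial ring, but they are not a tropical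 basis of $J$. More precisely, the weight vector $w\in\mathbb{R}^S$ with $w(E_1)=w(F_{13})=2$, with value $1$ at $E_2,E_4,E_5,E_6,F_{23},F_{34},F_{35},F_{36}$, and with value $0$ at the remaining 17 variables, satisfies $w\in\mathrm{Trop}(\mathcal{T}_d)$ and $w\notin\mathrm{Trop}(J)$, and the monomial $E_6F_{56}G_6$ lies in $\mathrm{in}_w(\langle\mathcal{T}_d\rangle)$ and in $\mathrm{in}_w(I_X)$. -/

import Mathlib

noncomputable section

namespace CubicCox

/-! ### Tropical geometry over a field with the trivial valuation (minimum convention)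

The valuation is trivial, so the residue field is the field itself, and the initial form of a
polynomial consists of its terms whose exponent has the smallest weight. -/

section Tropical

variable {k σ : Type*} [Field k] [Fintype σ]

/-- The Laurent polynomial ring `k[x_v^{±1} | v ∈ σ]`. -/
abbrev Laurent (k σ : Type*) [Field k] : Type _ := AddMonoidAlgebra k (σ →₀ ℤ)

/-- The inclusion `k[x] → k[x^{±1}]`, sending the variable `x_v` to the variable `x_v`. -/
def toLaurent (k σ : Type*) [Field k] : MvPolynomial σ k →ₐ[k] Laurent k σ :=
  MvPolynomial.aeval fun v => AddMonoidAlgebra.single (Finsupp.single v (1 : ℤ)) (1 : k)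

/-- The weight `w · α` of an exponent vector `α` of a Laurent monomial. -/
def laurentWeight (w : σ → ℝ) (α : σ →₀ ℤ) : ℝ := ∑ v, w v * (α v : ℝ)

/-- The initial form `in_w(f)` of a Laurent polynomial: the sum of its terms of least weight. -/
def laurentInitialForm (w : σ → ℝ) (f : Laurent k σ) : Laurent k σ := by
  classical
  exact ∑ α ∈ f.coeff.support.filter
      (fun α => ∀ β ∈ f.coeff.support, laurentWeight w α ≤ laurentWeight w β),
    AddMonoidAlgebra.single α (f.coeff α)

/-- `f` is a monomial: a single term with nonzero coefficient. -/
def IsLaurentMonomial (f : Laurent k σ) : Prop :=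
  ∃ (α : σ →₀ ℤ) (c : k), c ≠ 0 ∧ f = AddMonoidAlgebra.single α c

/-- `Trop(F)` for a set `F` of Laurent polynomials: the weights `w` such that `in_w(f)` is not a
monomial for all `f ∈ F`. It is called the tropical prevariety of `F`; for an ideal `I`, the set
`Trop(I)` is the tropical variety of `I`. -/
def Trop (F : Set (Laurent k σ)) : Set (σ → ℝ) :=
  {w | ∀ f ∈ F, ¬ IsLaurentMonomial (laurentInitialForm w f)}

/-- `F` is a tropical basis of the ideal `I`: it generates `I`, and its tropical prevariety is
the tropical variety of `I`. (That `F` is finite is not made part of the definition.) -/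
def IsTropicalBasis (F : Set (Laurent k σ)) (I : Ideal (Laurent k σ)) : Prop :=
  Ideal.span F = I ∧ Trop F = Trop (I : Set (Laurent k σ))

/-- The weight `w · α` of an exponent vector `α` of a monomial. -/
def weight (w : σ → ℝ) (α : σ →₀ ℕ) : ℝ := ∑ v, w v * (α v : ℝ)

/-- The initial form `in_w(f)` of a polynomial: the sum of its terms of least weight. -/
def initialForm (w : σ → ℝ) (f : MvPolynomial σ k) : MvPolynomial σ k := by
  classical
  exact ∑ α ∈ f.support.filter (fun α => ∀ β ∈ f.support, weight w α ≤ weight w β),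
    MvPolynomial.monomial α (f.coeff α)

/-- The initial ideal `in_w(I)`, generated by the initial forms of all elements of `I`. -/
def initialIdeal (w : σ → ℝ) (I : Ideal (MvPolynomial σ k)) : Ideal (MvPolynomial σ k) :=
  Ideal.span (initialForm w '' (I : Set (MvPolynomial σ k)))

/-- The saturation of an ideal of `k[x]` at the product of all variables. -/
def saturation (I : Ideal (MvPolynomial σ k)) : Ideal (MvPolynomial σ k) where
  carrier := {f | ∃ n : ℕ, (∏ v, MvPolynomial.X v) ^ n * f ∈ I}
  zero_mem' := ⟨0, by simp⟩
  add_mem' := by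
    rintro f g ⟨m, hm⟩ ⟨n, hn⟩
    refine ⟨m + n, ?_⟩
    have h1 := I.mul_mem_left ((∏ v, MvPolynomial.X v) ^ n) hm
    have h2 := I.mul_mem_left ((∏ v, MvPolynomial.X v) ^ m) hn
    have h3 := I.add_mem h1 h2
    convert h3 using 1
    ring
  smul_mem' := by
    rintro c f ⟨n, hn⟩
    refine ⟨n, ?_⟩
    have h := I.mul_mem_left c hn
    convert h using 1
    simp only [smul_eq_mul]
    ring

end Tropical

/-! ### The 27 lines and the Weyl group of type `E₆`

The index set `{1, …, 6}` is `Fin 6 = {0, …, 5}`: the mathematical index `i` is `i - 1` here. -/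

/-- The two-element subsets of the index set. -/
abbrev Pair : Type := {s : Finset (Fin 6) // s.card = 2}

/-- The pair `{i, j}`. -/
def pair (i j : Fin 6) (h : i ≠ j) : Pair := ⟨{i, j}, Finset.card_pair h⟩

/-- The 27 lines on the cubic surface: the exceptional divisors `E_i`, the strict transforms
`F_{ij}` of the lines through two of the points, and the strict transforms `G_i` of the conics
through all points but the `i`-th. They index the variables of the polynomial ring. -/
inductive Line : Type
  | E (i : Fin 6)
  | F (s : Pair)
  | G (i : Fin 6)
  deriving DecidableEq, Fintype

/-- The transposition `(i j)` acting on the two-element subsets. -/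
def swapPair (i j : Fin 6) : Equiv.Perm Pair :=
  (Equiv.swap i j).finsetCongr.subtypeEquiv fun s => by simp [Equiv.finsetCongr_apply]

/-- The transposition `(i j)` of the six points, acting on the 27 lines by permuting indices. -/
def swapLine (i j : Fin 6) : Equiv.Perm Line where
  toFun
    | .E a => .E (Equiv.swap i j a)
    | .F s => .F (swapPair i j s)
    | .G a => .G (Equiv.swap i j a)
  invFun
    | .E a => .E (Equiv.swap i j a)
    | .F s => .F ((swapPair i j).symm s)
    | .G a => .G (Equiv.swap i j a)
  left_inv := by rintro (a | s | a) <;> simp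
  right_inv := by rintro (a | s | a) <;> simp

/-- The quadratic Cremona transformation based at the first three points, acting on the 27 lines:
it exchanges `E₁ ↔ F₂₃`, `E₂ ↔ F₁₃`, `E₃ ↔ F₁₂`, `G₄ ↔ F₅₆`, `G₅ ↔ F₄₆`, `G₆ ↔ F₄₅` and fixes
the other 15 lines. -/
def cremonaLine : Equiv.Perm Line :=
  Equiv.swap (.E 0) (.F (pair 1 2 (by decide))) * Equiv.swap (.E 1) (.F (pair 0 2 (by decide))) *
  Equiv.swap (.E 2) (.F (pair 0 1 (by decide))) * Equiv.swap (.G 3) (.F (pair 4 5 (by decide))) *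
  Equiv.swap (.G 4) (.F (pair 3 5 (by decide))) * Equiv.swap (.G 5) (.F (pair 3 4 (by decide)))

/-- The parameter space, with coordinates `d_1, …, d_6`. -/
abbrev Params : Type := Fin 6 → ℂ

/-- The linear form `d_1 + d_2 + d_3`. -/
def cremonaRoot : Module.Dual ℂ Params :=
  LinearMap.proj (R := ℂ) (φ := fun _ : Fin 6 => ℂ) 0 +
    LinearMap.proj (R := ℂ) (φ := fun _ : Fin 6 => ℂ) 1 +
    LinearMap.proj (R := ℂ) (φ := fun _ : Fin 6 => ℂ) 2

/-- The coroot of `d_1 + d_2 + d_3`. -/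
def cremonaCoroot : Params := ![2/3, 2/3, 2/3, -1/3, -1/3, -1/3]

lemma cremonaRoot_coroot : cremonaRoot cremonaCoroot = 2 := by
  simp [cremonaRoot, cremonaCoroot]
  norm_num

/-- The reflection of the parameter space in the hyperplane `d_1 + d_2 + d_3 = 0`:
`d_i ↦ d_i - (2/3) (d_1 + d_2 + d_3)` for `i ≤ 3`, `d_i ↦ d_i + (1/3) (d_1 + d_2 + d_3)` for
`i ≥ 4`. -/
def cremonaParams : Params ≃ₗ[ℂ] Params := Module.reflection cremonaRoot_coroot

/-- The reflection of the parameter space in the hyperplane `d_i = d_j`, which exchanges `d_i`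
and `d_j`. -/
def swapParams (i j : Fin 6) : Params ≃ₗ[ℂ] Params :=
  LinearEquiv.funCongrLeft ℂ ℂ (Equiv.swap i j)

/-- The Weyl group of type `E₆`, acting simultaneously on the parameters `d` (as the reflection
group whose positive roots are `d_i - d_j`, `d_i + d_j + d_k` and `d_1 + ⋯ + d_6`) and on the 27
lines. It is generated by its six simple reflections, in the roots `d_i - d_{i+1}` and
`d_1 + d_2 + d_3`. -/
def weylE6 : Subgroup ((Params ≃ₗ[ℂ] Params) × Equiv.Perm Line) :=
  Subgroup.closure
    (Set.range (fun i : Fin 5 => (swapParams i.castSucc i.succ, swapLine i.castSucc i.succ)) ∪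
      {(cremonaParams, cremonaLine)})

/-! ### The trinomials and the Cox ideal -/

open MvPolynomial in
/-- For `1 < j < k < l`, the trinomial
`(d_k - d_l)(d_1 + d_k + d_l) E_j F_{1j} - (d_j - d_l)(d_1 + d_j + d_l) E_k F_{1k}
  + (d_j - d_k)(d_1 + d_j + d_k) E_l F_{1l}`. There are ten of them. -/
def baseTrinomial (j k l : Fin 6) (hj : 0 < j) (hjk : j < k) (hkl : k < l) (d : Params) :
    MvPolynomial Line ℂ :=
  C ((d k - d l) * (d 0 + d k + d l)) * X (.E j) * X (.F (pair 0 j hj.ne))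
    - C ((d j - d l) * (d 0 + d j + d l)) * X (.E k) * X (.F (pair 0 k (hj.trans hjk).ne))
    + C ((d j - d k) * (d 0 + d j + d k)) * X (.E l)
        * X (.F (pair 0 l ((hj.trans hjk).trans hkl).ne))

/-- The ten trinomials and all their translates under the Weyl group, at the parameter `d`.
An element `g` of the Weyl group carries a family `d ↦ f_d` of polynomials in the 27 variables to
the family `d ↦ g (f_{g⁻¹ d})`, where `g` permutes the variables. Up to sign these are 270
trinomials. -/
def trinomials (d : Params) : Set (MvPolynomial Line ℂ) :=
  {f | ∃ g ∈ weylE6, ∃ (j k l : Fin 6) (hj : 0 < j) (hjk : j < k) (hkl : k < l),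
    f = MvPolynomial.rename g.2 (baseTrinomial j k l hj hjk hkl (g.1.symm d))}

/-- The ideal of `ℂ[E, F, G]` generated by the trinomials. -/
def trinomialIdeal (d : Params) : Ideal (MvPolynomial Line ℂ) := Ideal.span (trinomials d)

/-- The Cox ideal `I_X` of the blow-up `X` of the plane in the six points `(1 : d_i : d_i³)`:
the saturation at the product of all variables of the ideal generated by the trinomials. -/
def coxIdeal (d : Params) : Ideal (MvPolynomial Line ℂ) := saturation (trinomialIdeal d)

/-- The trinomials, as Laurent polynomials. -/
def laurentTrinomials (d : Params) : Set (Laurent ℂ Line) := toLaurent ℂ Line '' trinomials d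

/-- The ideal generated by the Cox ideal in the Laurent polynomial ring. -/
def laurentCoxIdeal (d : Params) : Ideal (Laurent ℂ Line) :=
  (coxIdeal d).map (toLaurent ℂ Line)

/-- The weight vector with `E_1 ↦ 2`, `E_2, E_4, E_5, E_6 ↦ 1`, `F_{13} ↦ 2`,
`F_{23}, F_{34}, F_{35}, F_{36} ↦ 1`, and value `0` at the other 17 lines. -/
def coxWeight : Line → ℝ
  | .E i => ![2, 1, 0, 1, 1, 1] i
  | .F s => if s.1 = {0, 2} then 2 else if 2 ∈ s.1 then 1 else 0
  | .G _ => 0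

/-- The monomial `E_6 F_{56} G_6`. -/
def monomialE6F56G6 : MvPolynomial Line ℂ :=
  MvPolynomial.X (.E 5) * MvPolynomial.X (.F (pair 4 5 (by decide))) * MvPolynomial.X (.G 5)

end CubicCox

end

/-! Every trinomial belongs to one of the 27 lines. The base trinomials belong to G₁: their terms
E_i F_{1i} are three of the five pairs of lines that complete G₁ to a tritangent triangle. Since
W(E₆) preserves incidence, each translate uses three of the five pairs attached to another line L.
For the given w, at least four of the five pair weights at every L equal the minimum
(`exists_min_coxWeightNat`, a finite check). So every trinomial attains its least weight at least
twice, and w lies in the prevariety once the coefficients, which are products of two roots, are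
nonzero (`coxWeight_mem_Trop`).

To leave Trop(J), consider the trinomials on F₁₃F₄₅, E₂G₆, E₆G₂ (at F₂₆), on E₁F₁₅, E₂F₂₅, E₆F₅₆ (at
G₅) and on G₆F₅₆, F₃₅G₃, F₂₅G₂ (at E₅). Multiplied by F₂₅, G₆ and E₆, they have initial forms that
are binomials in only three monomials of weight 1, namely E₂F₂₅G₆, E₆F₂₅G₂ and E₆F₅₆G₆. Eliminating
the first two leaves `leadCoeff d` times E₆F₅₆G₆ plus terms of weight 2
(`exists_cubic_mem_trinomialIdeal`). For generic d this coefficient is nonzero, so the initial form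
is a monomial.

Generation of J is formal: the variables are units in the Laurent ring, so saturating changes
nothing there. -/

noncomputable section

namespace CubicCox

/-! ### Initial forms and passage to Laurent polynomials -/

section Initial

variable {k σ : Type*} [Field k] [Fintype σ]

lemma laurentWeight_add (w : σ → ℝ) (α β : σ →₀ ℤ) :
    laurentWeight w (α + β) = laurentWeight w α + laurentWeight w β := by
  simp [laurentWeight, mul_add, Finset.sum_add_distrib]

lemma laurentWeight_single (w : σ → ℝ) (v : σ) :
    laurentWeight w (Finsupp.single v 1) = w v := by
  classical
  simp [laurentWeight, Finsupp.single_apply]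

lemma weight_add (w : σ → ℝ) (α β : σ →₀ ℕ) :
    weight w (α + β) = weight w α + weight w β := by
  simp [weight, mul_add, Finset.sum_add_distrib]

lemma weight_single (w : σ → ℝ) (v : σ) : weight w (Finsupp.single v 1) = w v := by
  classical
  simp [weight, Finsupp.single_apply]

/-- If one term of a Laurent polynomial has weight below all others, it is the initial form. -/
lemma laurentInitialForm_single_add (w : σ → ℝ) {α : σ →₀ ℤ} {c : k} (hc : c ≠ 0)
    {h : Laurent k σ} (hh : ∀ β ∈ h.coeff.support, laurentWeight w α < laurentWeight w β) :
    laurentInitialForm w (AddMonoidAlgebra.single α c + h) = AddMonoidAlgebra.single α c := by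
  classical
  have hα : h.coeff α = 0 := by
    by_contra hne
    exact lt_irrefl _ (hh α (Finsupp.mem_support_iff.mpr hne))
  have hcα : (AddMonoidAlgebra.single α c + h).coeff α = c := by
    simp [hα]
  have hmem : α ∈ (AddMonoidAlgebra.single α c + h).coeff.support := by
    rw [Finsupp.mem_support_iff, hcα]; exact hc
  have hlt : ∀ β ∈ (AddMonoidAlgebra.single α c + h).coeff.support, β ≠ α →
      laurentWeight w α < laurentWeight w β := by
    intro β hβ hne
    refine hh β ?_
    rw [Finsupp.mem_support_iff] at hβ ⊢
    simpa [Finsupp.single_apply, hne.symm] using hβ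
  have hfilter : (AddMonoidAlgebra.single α c + h).coeff.support.filter
      (fun β => ∀ γ ∈ (AddMonoidAlgebra.single α c + h).coeff.support,
        laurentWeight w β ≤ laurentWeight w γ) = {α} := by
    ext β
    rw [Finset.mem_filter, Finset.mem_singleton]
    constructor
    · rintro ⟨hβ, hmin⟩
      by_contra hne
      exact (hlt β hβ hne).not_ge (hmin α hmem)
    · rintro rfl
      refine ⟨hmem, fun γ hγ => ?_⟩
      by_cases hne : γ = β
      · rw [hne]
      · exact (hlt γ hγ hne).le
  unfold laurentInitialForm
  convert Finset.sum_singleton (fun β => AddMonoidAlgebra.single β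
    ((AddMonoidAlgebra.single α c + h).coeff β)) α using 2
  rw [hcα]

/-- If one term of a polynomial has weight below all others, it is the initial form. -/
lemma initialForm_monomial_add (w : σ → ℝ) {α : σ →₀ ℕ} {c : k} (hc : c ≠ 0)
    {h : MvPolynomial σ k} (hh : ∀ β ∈ h.support, weight w α < weight w β) :
    initialForm w (MvPolynomial.monomial α c + h) = MvPolynomial.monomial α c := by
  classical
  have hα : h.coeff α = 0 := by
    by_contra hne
    exact lt_irrefl _ (hh α (MvPolynomial.mem_support_iff.mpr hne))
  have hcα : (MvPolynomial.monomial α c + h).coeff α = c := by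
    simp [hα]
  have hmem : α ∈ (MvPolynomial.monomial α c + h).support := by
    rw [MvPolynomial.mem_support_iff, hcα]; exact hc
  have hlt : ∀ β ∈ (MvPolynomial.monomial α c + h).support, β ≠ α →
      weight w α < weight w β := by
    intro β hβ hne
    refine hh β ?_
    rw [MvPolynomial.mem_support_iff] at hβ ⊢
    simpa [MvPolynomial.coeff_monomial, hne.symm] using hβ
  have hfilter : (MvPolynomial.monomial α c + h).support.filter
      (fun β => ∀ γ ∈ (MvPolynomial.monomial α c + h).support,
        weight w β ≤ weight w γ) = {α} := by
    ext β
    rw [Finset.mem_filter, Finset.mem_singleton]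
    constructor
    · rintro ⟨hβ, hmin⟩
      by_contra hne
      exact (hlt β hβ hne).not_ge (hmin α hmem)
    · rintro rfl
      refine ⟨hmem, fun γ hγ => ?_⟩
      by_cases hne : γ = β
      · rw [hne]
      · exact (hlt γ hγ hne).le
  unfold initialForm
  convert Finset.sum_singleton (fun β => MvPolynomial.monomial β
    ((MvPolynomial.monomial α c + h).coeff β)) α using 2
  rw [hcα]

/-- A Laurent polynomial whose least weight is attained by two terms has an initial form that is
not a monomial. -/
lemma not_isLaurentMonomial_laurentInitialForm (w : σ → ℝ) {f : Laurent k σ} {α β : σ →₀ ℤ}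
    (hαβ : α ≠ β) (hα : α ∈ f.coeff.support) (hβ : β ∈ f.coeff.support)
    (hαmin : ∀ γ ∈ f.coeff.support, laurentWeight w α ≤ laurentWeight w γ)
    (hβmin : ∀ γ ∈ f.coeff.support, laurentWeight w β ≤ laurentWeight w γ) :
    ¬ IsLaurentMonomial (laurentInitialForm w f) := by
  classical
  have key : ∀ δ ∈ f.coeff.support,
      (∀ γ ∈ f.coeff.support, laurentWeight w δ ≤ laurentWeight w γ) →
      (laurentInitialForm w f).coeff δ ≠ 0 := by
    intro δ hδ hmin
    unfold laurentInitialForm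
    rw [AddMonoidAlgebra.coeff_sum, Finsupp.finsetSum_apply, Finset.sum_eq_single δ]
    · simpa using hδ
    · intro γ _ hne
      simp [hne]
    · intro hnot
      exact absurd (Finset.mem_filter.mpr ⟨hδ, hmin⟩) hnot
  rintro ⟨γ, c, -, hf⟩
  have h1 := key α hα hαmin
  have h2 := key β hβ hβmin
  rw [hf, AddMonoidAlgebra.coeff_single, Finsupp.single_apply] at h1 h2
  have e1 : γ = α := by by_contra h; simp [h] at h1
  have e2 : γ = β := by by_contra h; simp [h] at h2
  exact hαβ (e1.symm.trans e2)

omit [Fintype σ] in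
lemma toLaurent_C (c : k) :
    toLaurent k σ (MvPolynomial.C c) = AddMonoidAlgebra.single 0 c := by
  rw [toLaurent, MvPolynomial.aeval_C]; rfl

omit [Fintype σ] in
lemma toLaurent_X (v : σ) :
    toLaurent k σ (MvPolynomial.X v) = AddMonoidAlgebra.single (Finsupp.single v 1) 1 := by
  rw [toLaurent, MvPolynomial.aeval_X]

/-- The product of all variables is a unit in the Laurent polynomial ring. -/
lemma isUnit_toLaurent_prod_X :
    IsUnit (toLaurent k σ (∏ v, MvPolynomial.X v)) := by
  rw [map_prod, IsUnit.prod_univ_iff]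
  intro v
  rw [toLaurent_X]
  refine IsUnit.of_mul_eq_one (AddMonoidAlgebra.single (-Finsupp.single v 1) 1) ?_
  rw [AddMonoidAlgebra.single_mul_single, add_neg_cancel, mul_one]
  rfl

lemma le_saturation (I : Ideal (MvPolynomial σ k)) : I ≤ saturation I :=
  fun f hf => ⟨0, by simpa using hf⟩

/-- An ideal and its saturation generate the same ideal of Laurent polynomials. -/
lemma map_toLaurent_saturation (I : Ideal (MvPolynomial σ k)) :
    (saturation I).map (toLaurent k σ) = I.map (toLaurent k σ) := by
  refine le_antisymm ?_ (Ideal.map_mono (le_saturation I))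
  rw [Ideal.map_le_iff_le_comap]
  rintro f ⟨n, hn⟩
  have h := Ideal.mem_map_of_mem (toLaurent k σ) hn
  rw [map_mul, map_pow] at h
  exact (Ideal.unit_mul_mem_iff_mem _ (isUnit_toLaurent_prod_X.pow n)).mp h

end Initial

/-! ### Incidence of the 27 lines and the weight -/

/-- Whether two different lines meet. -/
def Meets : Line → Line → Prop
  | .E _, .E _ => False
  | .E i, .F s => i ∈ s.1
  | .E i, .G j => i ≠ j
  | .F s, .E i => i ∈ s.1
  | .F s, .F t => Disjoint s.1 t.1
  | .F s, .G i => i ∈ s.1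
  | .G j, .E i => i ≠ j
  | .G i, .F s => i ∈ s.1
  | .G _, .G _ => False

instance : DecidableRel Meets := fun L M => by
  cases L <;> cases M <;> unfold Meets <;> infer_instance

lemma mem_swapPair (i j a : Fin 6) (s : Pair) :
    Equiv.swap i j a ∈ (swapPair i j s).1 ↔ a ∈ s.1 := by
  simp [swapPair, Equiv.finsetCongr_apply]

lemma disjoint_swapPair (i j : Fin 6) (s t : Pair) :
    Disjoint (swapPair i j s).1 (swapPair i j t).1 ↔ Disjoint s.1 t.1 := by
  simp [swapPair, Equiv.finsetCongr_apply]

lemma meets_swapLine (i j : Fin 6) (L M : Line) :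
    Meets (swapLine i j L) (swapLine i j M) ↔ Meets L M := by
  cases L <;> cases M <;> simp [Meets, swapLine, mem_swapPair, disjoint_swapPair]

lemma meets_cremonaLine (L M : Line) :
    Meets (cremonaLine L) (cremonaLine M) ↔ Meets L M := by
  revert L M
  decide +kernel

/-- `coxWeight` with values in the natural numbers. -/
def coxWeightNat : Line → ℕ
  | .E i => ![2, 1, 0, 1, 1, 1] i
  | .F s => if s.1 = {0, 2} then 2 else if 2 ∈ s.1 then 1 else 0
  | .G _ => 0

lemma coxWeight_eq_natCast (L : Line) : coxWeight L = coxWeightNat L := by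
  rcases L with i | s | i
  · fin_cases i <;> simp [coxWeight, coxWeightNat]
  · simp only [coxWeight, coxWeightNat]
    split_ifs <;> simp
  · simp [coxWeight, coxWeightNat]

/-- Among the five pairs of lines forming a tritangent plane with a given line, at most one pair
has weight exceeding the minimum. -/
lemma exists_min_coxWeightNat (L : Line) : ∃ m ≤ 2, ∃ M : Line, ∀ A, Meets L A →
    ∀ B, Meets L B → Meets A B → coxWeightNat A + coxWeightNat B = m ∨
      m ≤ coxWeightNat A + coxWeightNat B ∧ (M = A ∨ M = B) := by
  -- The five pairs at L are disjoint, so naming one line M singles out the exceptional pair. The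
  -- bound on m makes the statement decidable.
  revert L
  decide +kernel

/-! ### Regular parameters and the Weyl group -/

lemma swapParams_apply (i j : Fin 6) (d : Params) (a : Fin 6) :
    swapParams i j d a = d (Equiv.swap i j a) := rfl

lemma swapParams_symm (i j : Fin 6) : (swapParams i j).symm = swapParams i j := by
  ext d a
  simp [swapParams]

lemma cremonaParams_apply (d : Params) (a : Fin 6) :
    cremonaParams d a = d a - (d 0 + d 1 + d 2) * cremonaCoroot a := by
  simp [cremonaParams, Module.reflection_apply, cremonaRoot]

lemma cremonaParams_symm : cremonaParams.symm = cremonaParams := by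
  simp [cremonaParams]

/-- No root of the root system `E₆` vanishes at `d`. -/
structure IsRegular (d : Params) : Prop where
  sub_ne : ∀ i j, i ≠ j → d i - d j ≠ 0
  add_ne : ∀ i j k, i ≠ j → i ≠ k → j ≠ k → d i + d j + d k ≠ 0
  sum_ne : ∑ i, d i ≠ 0

lemma IsRegular.swapParams {d : Params} (hd : IsRegular d) (i j : Fin 6) :
    IsRegular (swapParams i j d) where
  sub_ne a b hab := hd.sub_ne _ _ (by simpa using hab)
  add_ne a b c hab hac hbc := hd.add_ne _ _ _ (by simpa using hab) (by simpa using hac)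
    (by simpa using hbc)
  sum_ne := by
    have h := Equiv.sum_comp (Equiv.swap i j) d
    simpa only [swapParams_apply, h] using hd.sum_ne

/-- Up to sign and order of summands only the 36 positive roots matter, which keeps the case check
for the Cremona reflection short. -/
lemma IsRegular.of_lt {d : Params} (h₁ : ∀ i j, i < j → d i - d j ≠ 0)
    (h₂ : ∀ i j k, i < j → j < k → d i + d j + d k ≠ 0) (h₃ : ∑ i, d i ≠ 0) :
    IsRegular d where
  sub_ne i j hij := by
    rcases hij.lt_or_gt with h | h
    · exact h₁ i j h
    · rw [← neg_ne_zero, neg_sub]; exact h₁ j i h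
  add_ne i j k hij hik hjk := by
    rcases hij.lt_or_gt with h | h <;> rcases hik.lt_or_gt with h' | h' <;>
      rcases hjk.lt_or_gt with h'' | h''
    · exact h₂ i j k h h''
    · rw [add_right_comm]; exact h₂ i k j h' h''
    · exact absurd (h.trans h'') h'.not_gt
    · rw [add_comm, ← add_assoc]; exact h₂ k i j h' h
    · rw [add_comm (d i)]; exact h₂ j i k h h'
    · exact absurd (h''.trans h) h'.not_gt
    · rw [add_right_comm, add_comm, ← add_assoc, add_right_comm]; exact h₂ j k i h'' h'
    · rw [add_comm, add_comm (d i), ← add_assoc]; exact h₂ k j i h'' h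
  sum_ne := h₃

/-- The reflection permutes the roots up to sign. With s = d₁ + d₂ + d₃, a difference d_i - d_j with
i ≤ 3 < j becomes d_i - d_j - s, the negative of a triple sum. A triple sum with two indices ≤ 3
loses s and becomes a difference, s changes sign, and d₄ + d₅ + d₆ is exchanged with the sum of all
d_i. The other roots are fixed. -/
lemma IsRegular.cremonaParams {d : Params} (hd : IsRegular d) :
    IsRegular (cremonaParams d) := by
  have h₁ := hd.sub_ne
  have h₂ := hd.add_ne
  have h₃ := hd.sum_ne
  simp only [Fin.sum_univ_six] at h₃
  refine IsRegular.of_lt (fun i j hij h => ?_) (fun i j k hij hjk h => ?_) (fun h => ?_)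
  · fin_cases i <;> fin_cases j <;> first
      | exact absurd hij (by decide)
      | (simp [cremonaParams_apply, cremonaCoroot] at h
         first
          | exact h₁ 0 1 (by decide) (by linear_combination h)
          | exact h₁ 0 2 (by decide) (by linear_combination h)
          | exact h₁ 1 2 (by decide) (by linear_combination h)
          | exact h₁ 3 4 (by decide) (by linear_combination h)
          | exact h₁ 3 5 (by decide) (by linear_combination h)
          | exact h₁ 4 5 (by decide) (by linear_combination h)
          | exact h₂ 0 1 3 (by decide) (by decide) (by decide) (by linear_combination -h)
          | exact h₂ 0 2 3 (by decide) (by decide) (by decide) (by linear_combination -h)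
          | exact h₂ 1 2 3 (by decide) (by decide) (by decide) (by linear_combination -h)
          | exact h₂ 0 1 4 (by decide) (by decide) (by decide) (by linear_combination -h)
          | exact h₂ 0 2 4 (by decide) (by decide) (by decide) (by linear_combination -h)
          | exact h₂ 1 2 4 (by decide) (by decide) (by decide) (by linear_combination -h)
          | exact h₂ 0 1 5 (by decide) (by decide) (by decide) (by linear_combination -h)
          | exact h₂ 0 2 5 (by decide) (by decide) (by decide) (by linear_combination -h)
          | exact h₂ 1 2 5 (by decide) (by decide) (by decide) (by linear_combination -h))
  · have e : ∀ a b c, CubicCox.cremonaParams d a + CubicCox.cremonaParams d b +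
        CubicCox.cremonaParams d c = d a + d b + d c - (d 0 + d 1 + d 2) *
          (cremonaCoroot a + cremonaCoroot b + cremonaCoroot c) := by
      intro a b c
      simp only [cremonaParams_apply]
      ring
    rw [e] at h
    fin_cases i <;> fin_cases j <;> first
      | exact absurd hij (by decide)
      | (fin_cases k <;> first
          | exact absurd hjk (by decide)
          | (simp [cremonaCoroot] at h
             first
              | exact h₂ 0 1 2 (by decide) (by decide) (by decide) (by linear_combination -h)
              | exact h₁ 3 0 (by decide) (by linear_combination h)
              | exact h₁ 3 1 (by decide) (by linear_combination h)
              | exact h₁ 3 2 (by decide) (by linear_combination h)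
              | exact h₁ 4 0 (by decide) (by linear_combination h)
              | exact h₁ 4 1 (by decide) (by linear_combination h)
              | exact h₁ 4 2 (by decide) (by linear_combination h)
              | exact h₁ 5 0 (by decide) (by linear_combination h)
              | exact h₁ 5 1 (by decide) (by linear_combination h)
              | exact h₁ 5 2 (by decide) (by linear_combination h)
              | exact h₂ 0 3 4 (by decide) (by decide) (by decide) (by linear_combination h)
              | exact h₂ 0 3 5 (by decide) (by decide) (by decide) (by linear_combination h)
              | exact h₂ 0 4 5 (by decide) (by decide) (by decide) (by linear_combination h)
              | exact h₂ 1 3 4 (by decide) (by decide) (by decide) (by linear_combination h)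
              | exact h₂ 1 3 5 (by decide) (by decide) (by decide) (by linear_combination h)
              | exact h₂ 1 4 5 (by decide) (by decide) (by decide) (by linear_combination h)
              | exact h₂ 2 3 4 (by decide) (by decide) (by decide) (by linear_combination h)
              | exact h₂ 2 3 5 (by decide) (by decide) (by decide) (by linear_combination h)
              | exact h₂ 2 4 5 (by decide) (by decide) (by decide) (by linear_combination h)
              | exact h₃ (by linear_combination h)))
  · simp [Fin.sum_univ_six, cremonaParams_apply, cremonaCoroot] at h
    exact h₂ 3 4 5 (by decide) (by decide) (by decide) (by linear_combination h)

/-- The Weyl group preserves regularity of parameters and incidence of lines. -/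
lemma isRegular_and_meets_iff {g : (Params ≃ₗ[ℂ] Params) × Equiv.Perm Line} (hg : g ∈ weylE6) :
    (∀ d, IsRegular (g.1 d) ↔ IsRegular d) ∧ ∀ L M, Meets (g.2 L) (g.2 M) ↔ Meets L M := by
  induction hg using Subgroup.closure_induction with
  | mem x hx =>
    rcases hx with ⟨i, rfl⟩ | rfl
    · refine ⟨fun d => ⟨fun h => ?_, fun h => h.swapParams _ _⟩, meets_swapLine _ _⟩
      -- A reflection is an involution, so applying it again gives the converse.
      have h' := h.swapParams i.castSucc i.succ
      dsimp only at h'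
      nth_rw 1 [← swapParams_symm] at h'
      rwa [LinearEquiv.symm_apply_apply] at h'
    · refine ⟨fun d => ⟨fun h => ?_, fun h => h.cremonaParams⟩, meets_cremonaLine⟩
      have h' := h.cremonaParams
      dsimp only at h'
      nth_rw 1 [← cremonaParams_symm] at h'
      rwa [LinearEquiv.symm_apply_apply] at h'
  | one => exact ⟨fun d => Iff.rfl, fun L M => Iff.rfl⟩
  | mul x y _ _ hx hy =>
    exact ⟨fun d => (hx.1 (y.1 d)).trans (hy.1 d), fun L M => (hx.2 _ _).trans (hy.2 L M)⟩
  | inv x _ hx =>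
    refine ⟨fun d => ?_, fun L M => ?_⟩
    · have h := hx.1 (x.1⁻¹ d)
      rw [← LinearEquiv.mul_apply, mul_inv_cancel] at h
      exact h.symm
    · have h := hx.2 (x.2⁻¹ L) (x.2⁻¹ M)
      rw [← Equiv.Perm.mul_apply, ← Equiv.Perm.mul_apply, mul_inv_cancel] at h
      exact h.symm

/-! ### The weight lies in the tropical prevariety -/

/-- The trinomial with coefficients `a`, `-b`, `c` at three products of two variables. -/
def trinomial {k σ : Type*} [Field k] (a b c : k) (u u' v v' x x' : σ) : MvPolynomial σ k :=
  MvPolynomial.C a * MvPolynomial.X u * MvPolynomial.X u' -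
    MvPolynomial.C b * MvPolynomial.X v * MvPolynomial.X v' +
    MvPolynomial.C c * MvPolynomial.X x * MvPolynomial.X x'

lemma baseTrinomial_eq (j k l : Fin 6) (hj : 0 < j) (hjk : j < k) (hkl : k < l) (d : Params) :
    baseTrinomial j k l hj hjk hkl d =
      trinomial ((d k - d l) * (d 0 + d k + d l)) ((d j - d l) * (d 0 + d j + d l))
        ((d j - d k) * (d 0 + d j + d k)) (.E j) (.F (pair 0 j hj.ne)) (.E k)
        (.F (pair 0 k (hj.trans hjk).ne)) (.E l)
        (.F (pair 0 l ((hj.trans hjk).trans hkl).ne)) :=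
  rfl

lemma rename_trinomial {k σ τ : Type*} [Field k] (g : σ → τ) (a b c : k) (u u' v v' x x' : σ) :
    MvPolynomial.rename g (trinomial a b c u u' v v' x x') =
      trinomial a b c (g u) (g u') (g v) (g v') (g x) (g x') := by
  simp only [trinomial, map_add, map_sub, map_mul, MvPolynomial.rename_C, MvPolynomial.rename_X]

lemma toLaurent_trinomial {k σ : Type*} [Field k] (a b c : k) (u u' v v' x x' : σ) :
    toLaurent k σ (trinomial a b c u u' v v' x x') =
      AddMonoidAlgebra.single (Finsupp.single u 1 + Finsupp.single u' 1) a +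
      AddMonoidAlgebra.single (Finsupp.single v 1 + Finsupp.single v' 1) (-b) +
      AddMonoidAlgebra.single (Finsupp.single x 1 + Finsupp.single x' 1) c := by
  rw [trinomial, map_add, map_sub, sub_eq_add_neg, AddMonoidAlgebra.single_neg]
  simp only [map_mul, toLaurent_C, toLaurent_X, AddMonoidAlgebra.single_mul_single, mul_one,
    zero_add]

lemma single_add_single_ne {σ : Type*} {u u' v v' : σ} (h : u ≠ v) (h' : u ≠ v') :
    (Finsupp.single u (1 : ℤ) + Finsupp.single u' 1) ≠
      Finsupp.single v 1 + Finsupp.single v' 1 := by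
  classical
  intro he
  have h1 := DFunLike.congr_fun he u
  simp only [Finsupp.add_apply, Finsupp.single_eq_same, Finsupp.single_eq_of_ne h,
    Finsupp.single_eq_of_ne h', add_zero] at h1
  -- Since u' may equal u, only nonnegativity of this entry is available; it suffices.
  have h2 : (0 : ℤ) ≤ Finsupp.single u' (1 : ℤ) u := by
    rw [Finsupp.single_apply]; split_ifs <;> simp
  omega

/-- A sum of three terms with nonzero coefficients and different exponents, two of which have the
least weight, has an initial form that is not a monomial. -/
lemma not_isLaurentMonomial_three {k σ : Type*} [Field k] [Fintype σ] (w : σ → ℝ)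
    {a b c : k} (ha : a ≠ 0) (hb : b ≠ 0) {α β γ : σ →₀ ℤ}
    (hαβ : α ≠ β) (hαγ : α ≠ γ) (hβγ : β ≠ γ)
    (h : laurentWeight w α = laurentWeight w β) (h' : laurentWeight w α ≤ laurentWeight w γ) :
    ¬ IsLaurentMonomial (laurentInitialForm w (AddMonoidAlgebra.single α a +
      AddMonoidAlgebra.single β b + AddMonoidAlgebra.single γ c)) := by
  classical
  have hmem : ∀ δ ∈ (AddMonoidAlgebra.single α a + AddMonoidAlgebra.single β b +
      AddMonoidAlgebra.single γ c : Laurent k σ).coeff.support,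
      laurentWeight w α ≤ laurentWeight w δ := by
    intro δ hδ
    by_cases h1 : α = δ
    · rw [h1]
    by_cases h2 : β = δ
    · rw [h, h2]
    by_cases h3 : γ = δ
    · rw [← h3]; exact h'
    simp [h1, h2, h3] at hδ
  refine not_isLaurentMonomial_laurentInitialForm w hαβ ?_ ?_ hmem (h ▸ hmem)
  · simp [hαβ.symm, hαγ.symm, ha]
  · simp [hαβ, hβγ.symm, hb]

/-- In a translate by g the three terms are pairs of lines attached to g(G₁). At most one of them
exceeds the minimal pair weight there, so the other two tie. Regularity keeps their coefficients
nonzero. -/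
lemma coxWeight_mem_Trop {d : Params} (hd : IsRegular d) :
    coxWeight ∈ Trop (laurentTrinomials d) := by
  rintro _ ⟨_, ⟨g, hg, j, k, l, hj, hjk, hkl, rfl⟩, rfl⟩
  obtain ⟨hreg, hmeets⟩ := isRegular_and_meets_iff hg
  have hd' : IsRegular (g.1.symm d) := by
    rw [← hreg, LinearEquiv.apply_symm_apply]; exact hd
  generalize g.1.symm d = e at hd'
  have hk := hj.trans hjk
  have hl := hk.trans hkl
  have ha : (e k - e l) * (e 0 + e k + e l) ≠ 0 :=
    mul_ne_zero (hd'.sub_ne _ _ hkl.ne) (hd'.add_ne _ _ _ hk.ne hl.ne hkl.ne)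
  have hb : (e j - e l) * (e 0 + e j + e l) ≠ 0 :=
    mul_ne_zero (hd'.sub_ne _ _ (hjk.trans hkl).ne)
      (hd'.add_ne _ _ _ hj.ne hl.ne (hjk.trans hkl).ne)
  have hc : (e j - e k) * (e 0 + e j + e k) ≠ 0 :=
    mul_ne_zero (hd'.sub_ne _ _ hjk.ne) (hd'.add_ne _ _ _ hj.ne hk.ne hjk.ne)
  have hE : ∀ {i i' : Fin 6}, i ≠ i' → g.2 (.E i) ≠ g.2 (.E i') := fun h => by simpa using h
  have hEF : ∀ i s, g.2 (.E i) ≠ g.2 (.F s) := fun i s => by simp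
  -- G₁ meets E_i and F_{1i} for every i ≠ 1, and these two meet each other.
  obtain ⟨m, -, M, hM⟩ := exists_min_coxWeightNat (g.2 (.G 0))
  have hpair : ∀ (i : Fin 6) (hi : 0 < i),
      coxWeightNat (g.2 (.E i)) + coxWeightNat (g.2 (.F (pair 0 i hi.ne))) = m ∨
      m ≤ coxWeightNat (g.2 (.E i)) + coxWeightNat (g.2 (.F (pair 0 i hi.ne))) ∧
        (M = g.2 (.E i) ∨ M = g.2 (.F (pair 0 i hi.ne))) := fun i hi =>
    hM _ ((hmeets _ _).mpr (by simpa [Meets] using hi.ne'))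
      _ ((hmeets _ _).mpr (by simp [Meets, pair]))
      ((hmeets _ _).mpr (by simp [Meets, pair]))
  have hF : ∀ {i i' : Fin 6} (hi : 0 < i) (hi' : 0 < i'), i ≠ i' →
      g.2 (.F (pair 0 i hi.ne)) ≠ g.2 (.F (pair 0 i' hi'.ne)) := by
    intro i i' hi hi' hne
    simp only [ne_eq, EmbeddingLike.apply_eq_iff_eq, Line.F.injEq, pair, Subtype.mk.injEq]
    intro h
    have : i ∈ ({0, i'} : Finset (Fin 6)) := h ▸ by simp
    simp [hi.ne', hne] at this
  -- M lies in at most one of the pairs, as they are disjoint.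
  have huniq : ∀ {i i' : Fin 6} (hi : 0 < i) (hi' : 0 < i'), i ≠ i' →
      (M = g.2 (.E i) ∨ M = g.2 (.F (pair 0 i hi.ne))) →
      ¬ (M = g.2 (.E i') ∨ M = g.2 (.F (pair 0 i' hi'.ne))) := by
    rintro i i' hi hi' hne (rfl | rfl) (h | h)
    · exact hE hne h
    · exact hEF _ _ h
    · exact hEF _ _ h.symm
    · exact hF hi hi' hne h
  have hexp : ∀ {i i' : Fin 6} (hi : 0 < i) (hi' : 0 < i'), i ≠ i' →
      Finsupp.single (g.2 (.E i)) (1 : ℤ) + Finsupp.single (g.2 (.F (pair 0 i hi.ne))) 1 ≠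
      Finsupp.single (g.2 (.E i')) (1 : ℤ) + Finsupp.single (g.2 (.F (pair 0 i' hi'.ne))) 1 :=
    fun hi hi' hne => single_add_single_ne (hE hne) (hEF _ _)
  have hw : ∀ L M : Line, laurentWeight coxWeight (Finsupp.single L 1 + Finsupp.single M 1) =
      (coxWeightNat L + coxWeightNat M : ℕ) := fun L M => by
    rw [laurentWeight_add, laurentWeight_single, laurentWeight_single, coxWeight_eq_natCast,
      coxWeight_eq_natCast, Nat.cast_add]
  have hle : ∀ i hi, m ≤ coxWeightNat (g.2 (.E i)) + coxWeightNat (g.2 (.F (pair 0 i hi))) := by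
    intro i hi
    rcases hpair i (Fin.pos_of_ne_zero hi.symm) with h | h
    exacts [h.ge, h.1]
  rw [baseTrinomial_eq, rename_trinomial, toLaurent_trinomial]
  -- Split by which term may be exceptional (l, k or j), and move that term to the last place.
  rcases hpair j hj with h₁ | ⟨-, h₁⟩
  · rcases hpair k hk with h₂ | ⟨-, h₂⟩
    · refine not_isLaurentMonomial_three _ ha (neg_ne_zero.mpr hb) (hexp hj hk hjk.ne)
        (hexp hj hl (hjk.trans hkl).ne) (hexp hk hl hkl.ne) ?_ ?_
      · rw [hw, hw, h₁, h₂]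
      · rw [hw, hw, h₁]; exact_mod_cast hle _ _
    · have h₃ := (hpair l hl).resolve_right fun h => huniq hk hl hkl.ne h₂ h.2
      rw [add_right_comm]
      refine not_isLaurentMonomial_three _ ha hc (hexp hj hl (hjk.trans hkl).ne)
        (hexp hj hk hjk.ne) (hexp hl hk hkl.ne') ?_ ?_
      · rw [hw, hw, h₁, h₃]
      · rw [hw, hw, h₁]; exact_mod_cast hle _ _
  · have h₂ := (hpair k hk).resolve_right fun h => huniq hj hk hjk.ne h₁ h.2
    have h₃ := (hpair l hl).resolve_right fun h => huniq hj hl (hjk.trans hkl).ne h₁ h.2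
    rw [add_assoc, add_comm]
    refine not_isLaurentMonomial_three _ (neg_ne_zero.mpr hb) hc (hexp hk hl hkl.ne)
      (hexp hk hj hjk.ne') (hexp hl hj (hjk.trans hkl).ne') ?_ ?_
    · rw [hw, hw, h₂, h₃]
    · rw [hw, hw, h₂]; exact_mod_cast hle _ _

end CubicCox

end

/-! ### Three explicit translates of the base trinomials -/

noncomputable section

namespace CubicCox

open MvPolynomial

lemma rename_mem_trinomials {g : (Params ≃ₗ[ℂ] Params) × Equiv.Perm Line} (hg : g ∈ weylE6)
    {d : Params} {f : MvPolynomial Line ℂ} (hf : f ∈ trinomials (g.1.symm d)) :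
    rename g.2 f ∈ trinomials d := by
  obtain ⟨h, hh, j, k, l, hj, hjk, hkl, rfl⟩ := hf
  exact ⟨g * h, mul_mem hg hh, j, k, l, hj, hjk, hkl, rename_rename _ _ _⟩

/-- Decidable equality of lines that does not transport along equalities of pairs. Unlike the
derived instance it evaluates to a truth value whatever the order in which pairs are listed. -/
abbrev lineDecidableEq : DecidableEq Line
  | .E i, .E j => decidable_of_iff (i = j) (by simp)
  | .F s, .F t => decidable_of_iff (s.1 = t.1) (by simp [Subtype.ext_iff])
  | .G i, .G j => decidable_of_iff (i = j) (by simp)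
  | .E _, .F _ => isFalse (by simp)
  | .E _, .G _ => isFalse (by simp)
  | .F _, .E _ => isFalse (by simp)
  | .F _, .G _ => isFalse (by simp)
  | .G _, .E _ => isFalse (by simp)
  | .G _, .F _ => isFalse (by simp)

attribute [local instance] lineDecidableEq

/-- The simple reflections of the Weyl group: `some i` is the transposition of `i` and `i + 1`,
and `none` is the quadratic Cremona transformation. -/
def simpleReflection : Option (Fin 5) → (Params ≃ₗ[ℂ] Params) × Equiv.Perm Line
  | some i => (swapParams i.castSucc i.succ, swapLine i.castSucc i.succ)
  | none => (cremonaParams, cremonaLine)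

lemma simpleReflection_mem (s : Option (Fin 5)) : simpleReflection s ∈ weylE6 := by
  cases s with
  | none => exact Subgroup.subset_closure (Or.inr rfl)
  | some i => exact Subgroup.subset_closure (Or.inl ⟨i, rfl⟩)

lemma simpleReflection_symm (s : Option (Fin 5)) :
    (simpleReflection s).1.symm = (simpleReflection s).1 := by
  cases s with
  | none => exact cremonaParams_symm
  | some i => exact swapParams_symm _ _

/-- The action of the simple reflections on the lines, in a form suited to evaluation. -/
def lineReflection : Option (Fin 5) → Line → Line
  | some i => swapLine i.castSucc i.succ
  | none =>
    (Equiv.swap (.E 0) (.F (pair 1 2 (by decide))) * Equiv.swap (.E 1) (.F (pair 0 2 (by decide))) *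
      Equiv.swap (.E 2) (.F (pair 0 1 (by decide))) * Equiv.swap (.G 3) (.F (pair 4 5 (by decide))) *
      Equiv.swap (.G 4) (.F (pair 3 5 (by decide))) * Equiv.swap (.G 5) (.F (pair 3 4 (by decide))) :
      Equiv.Perm Line)

lemma simpleReflection_snd (s : Option (Fin 5)) :
    ⇑(simpleReflection s).2 = lineReflection s := by
  cases s with
  | some i => rfl
  | none =>
    simp only [simpleReflection, cremonaLine, lineReflection]
    -- The two sides differ only in the decidable equality used by `Equiv.swap`.
    congr!

/-- The translate of a base trinomial by a word in the simple reflections. -/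
lemma word_trinomial_mem (w : List (Option (Fin 5))) (j k l : Fin 6) (hj : 0 < j) (hjk : j < k)
    (hkl : k < l) (d e : Params) (he : w.foldl (fun d s => (simpleReflection s).1 d) d = e)
    (φ : Line → Line) (hφ : w.foldr (fun s φ => lineReflection s ∘ φ) id = φ) :
    trinomial ((e k - e l) * (e 0 + e k + e l)) ((e j - e l) * (e 0 + e j + e l))
      ((e j - e k) * (e 0 + e j + e k)) (φ (.E j)) (φ (.F (pair 0 j hj.ne))) (φ (.E k))
      (φ (.F (pair 0 k (hj.trans hjk).ne))) (φ (.E l))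
      (φ (.F (pair 0 l ((hj.trans hjk).trans hkl).ne))) ∈ trinomials d := by
  -- For g = s₁⋯sₙ the lines are moved by s₁ ∘ ⋯ ∘ sₙ, a right fold. The parameters are moved by g⁻¹
  -- = sₙ⋯s₁, which applies s₁ first, a left fold.
  induction w generalizing d φ with
  | nil =>
    subst he hφ
    refine ⟨1, one_mem _, j, k, l, hj, hjk, hkl, ?_⟩
    rw [baseTrinomial_eq, rename_trinomial]
    rfl
  | cons s w ih =>
    subst hφ
    have h := ih ((simpleReflection s).1 d) he _ rfl
    rw [← simpleReflection_symm] at h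
    have h' := rename_mem_trinomials (simpleReflection_mem s) h
    rwa [rename_trinomial, simpleReflection_snd] at h'

lemma simpleReflection_some_vec (a b c d e f : ℂ) :
    (simpleReflection (some 0)).1 ![a, b, c, d, e, f] = ![b, a, c, d, e, f] ∧
    (simpleReflection (some 1)).1 ![a, b, c, d, e, f] = ![a, c, b, d, e, f] ∧
    (simpleReflection (some 2)).1 ![a, b, c, d, e, f] = ![a, b, d, c, e, f] ∧
    (simpleReflection (some 3)).1 ![a, b, c, d, e, f] = ![a, b, c, e, d, f] ∧
    (simpleReflection (some 4)).1 ![a, b, c, d, e, f] = ![a, b, c, d, f, e] := by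
  refine ⟨?_, ?_, ?_, ?_, ?_⟩ <;> funext i <;> fin_cases i <;> rfl

lemma simpleReflection_none_vec (a b c d e f : ℂ) :
    (simpleReflection none).1 ![a, b, c, d, e, f] =
      ![a - (a + b + c) * (2 / 3), b - (a + b + c) * (2 / 3), c - (a + b + c) * (2 / 3),
        d + (a + b + c) * (1 / 3), e + (a + b + c) * (1 / 3), f + (a + b + c) * (1 / 3)] := by
  funext i
  fin_cases i <;> simp [simpleReflection, cremonaParams_apply, cremonaCoroot] <;> ring

lemma params_eta (d : Params) : d = ![d 0, d 1, d 2, d 3, d 4, d 5] := by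
  funext i
  fin_cases i <;> rfl

/-- A relation among `E₁F₁₅`, `E₂F₂₅`, `E₆F₅₆`. -/
lemma trinomial_E0F04_mem (d : Params) :
    trinomial ((d 1 - d 5) * (d 1 + d 4 + d 5)) ((d 0 - d 5) * (d 0 + d 4 + d 5))
      ((d 0 - d 1) * (d 0 + d 1 + d 4)) (.E 0) (.F (pair 0 4 (by decide))) (.E 1)
      (.F (pair 1 4 (by decide))) (.E 5) (.F (pair 4 5 (by decide))) ∈ trinomials d := by
  -- This word is a cycle of the first five indices that carries G₁ to G₅.
  have h := word_trinomial_mem [some 3, some 2, some 1, some 0] 1 2 5 (by decide) (by decide)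
    (by decide) d _ rfl _ rfl
  rw [params_eta d] at h
  simp only [List.foldl_cons, List.foldl_nil, simpleReflection_some_vec] at h
  rw [← params_eta d] at h
  convert h using 1
  congr 1
  · simp only [Matrix.cons_val]; ring
  · simp only [Matrix.cons_val]; ring
  · simp only [Matrix.cons_val]; ring
  all_goals decide +kernel

/-- A relation among `F₁₃F₃₅`, `E₂G₆`, `E₆G₂`. -/
lemma trinomial_F02F34_mem (d : Params) :
    trinomial ((d 1 - d 5) * (d 0 + d 1 + d 2 + d 3 + d 4 + d 5))
      (-(d 0 + d 2 + d 5) * (d 3 + d 4 + d 5)) (-(d 0 + d 1 + d 2) * (d 1 + d 3 + d 4))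
      (.F (pair 0 2 (by decide))) (.F (pair 3 4 (by decide))) (.E 1) (.G 5) (.E 5) (.G 1)
      ∈ trinomials d := by
  -- This word carries G₁ to G₄, then by the Cremona map to F₅₆, and finally to F₂₆.
  have h := word_trinomial_mem [some 1, some 2, some 3, none, some 2, some 1, some 0] 3 4 5
    (by decide) (by decide) (by decide) d _ rfl _ rfl
  rw [params_eta d] at h
  simp only [List.foldl_cons, List.foldl_nil, simpleReflection_some_vec,
    simpleReflection_none_vec] at h
  rw [← params_eta d] at h
  convert h using 1
  congr 1
  · simp only [Matrix.cons_val]; ring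
  · simp only [Matrix.cons_val]; ring
  · simp only [Matrix.cons_val]; ring
  all_goals decide +kernel

/-- A relation among `G₆F₅₆`, `G₃F₃₅`, `G₂F₂₅`. -/
lemma trinomial_G5F45_mem (d : Params) :
    trinomial ((d 1 - d 2) * (d 0 + d 3 + d 5)) ((d 0 + d 2 + d 3) * (d 1 - d 5))
      ((d 0 + d 1 + d 3) * (d 2 - d 5)) (.G 5) (.F (pair 4 5 (by decide)))
      (.F (pair 2 4 (by decide))) (.G 2) (.F (pair 1 4 (by decide))) (.G 1) ∈ trinomials d := by
  -- This word carries G₁ through F₅₆ and F₂₃ to E₁, and finally to E₅.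
  have h := word_trinomial_mem [some 3, some 2, some 1, some 0, none, some 2, some 1, some 3,
    some 2, some 4, some 3, none, some 2, some 1, some 0] 1 3 4
    (by decide) (by decide) (by decide) d _ rfl _ rfl
  rw [params_eta d] at h
  simp only [List.foldl_cons, List.foldl_nil, simpleReflection_some_vec,
    simpleReflection_none_vec] at h
  rw [← params_eta d] at h
  convert h using 1
  congr 1
  · simp only [Matrix.cons_val]; ring
  · simp only [Matrix.cons_val]; ring
  · simp only [Matrix.cons_val]; ring
  all_goals decide +kernel

end CubicCox

end

/-! ### The cubic whose initial form is a monomial -/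

noncomputable section

namespace CubicCox

open MvPolynomial

lemma weight_triple {σ : Type*} [Fintype σ] (w : σ → ℝ) (a b c : σ) :
    weight w (Finsupp.single a 1 + Finsupp.single b 1 + Finsupp.single c 1) =
      w a + w b + w c := by
  simp only [weight_add, weight_single]

/-- The coefficient of `E₆F₅₆G₆` in `exists_cubic_mem_trinomialIdeal`. It vanishes when three of
the lines of a plane model of the surface are concurrent. -/
def leadCoeff {R : Type*} [CommRing R] (d : Fin 6 → R) : R :=
  (d 0 + d 2 + d 5) * (d 3 + d 4 + d 5) * ((d 0 + d 1 + d 3) * (d 2 - d 5)) *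
      ((d 0 - d 1) * (d 0 + d 1 + d 4)) +
    (d 0 + d 1 + d 2) * (d 1 + d 3 + d 4) * ((d 0 - d 5) * (d 0 + d 4 + d 5)) *
      ((d 1 - d 2) * (d 0 + d 3 + d 5))

/-- The ideal of the trinomials contains a polynomial with terms `E₆F₅₆G₆`, `F₁₃F₂₅F₃₅`,
`E₁F₁₅G₆` and `E₆F₃₅G₃`. -/
lemma exists_cubic_mem_trinomialIdeal (d : Params) : ∃ a b c : ℂ,
    monomial (Finsupp.single (.E 5) 1 + Finsupp.single (.F (pair 4 5 (by decide))) 1 +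
        Finsupp.single (.G 5) 1) (leadCoeff d) +
      (monomial (Finsupp.single (.F (pair 0 2 (by decide))) 1 +
          Finsupp.single (.F (pair 3 4 (by decide))) 1 +
          Finsupp.single (.F (pair 1 4 (by decide))) 1) a +
        monomial (Finsupp.single (.E 0) 1 + Finsupp.single (.F (pair 0 4 (by decide))) 1 +
          Finsupp.single (.G 5) 1) b +
        monomial (Finsupp.single (.E 5) 1 + Finsupp.single (.F (pair 2 4 (by decide))) 1 +
          Finsupp.single (.G 2) 1) c) ∈ trinomialIdeal d := by
  have h₁ := Ideal.subset_span (trinomial_F02F34_mem d)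
  have h₂ := Ideal.subset_span (trinomial_E0F04_mem d)
  have h₃ := Ideal.subset_span (trinomial_G5F45_mem d)
  have hmon : ∀ (u v x : Line) (a : ℂ), (monomial (Finsupp.single u 1 + Finsupp.single v 1 +
      Finsupp.single x 1) a : MvPolynomial Line ℂ) = C a * X u * X v * X x := by
    intro u v x a
    simp only [X, C_apply, monomial_mul, mul_one, zero_add]
  refine ⟨(d 0 - d 5) * (d 0 + d 4 + d 5) * ((d 0 + d 1 + d 3) * (d 2 - d 5)) *
      ((d 1 - d 5) * (d 0 + d 1 + d 2 + d 3 + d 4 + d 5)),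
    (d 0 + d 2 + d 5) * (d 3 + d 4 + d 5) * ((d 0 + d 1 + d 3) * (d 2 - d 5)) *
      ((d 1 - d 5) * (d 1 + d 4 + d 5)),
    -((d 0 + d 1 + d 2) * (d 1 + d 3 + d 4) * ((d 0 - d 5) * (d 0 + d 4 + d 5)) *
      ((d 0 + d 2 + d 3) * (d 1 - d 5))), ?_⟩
  -- The scalar multipliers are products of coefficients of the other trinomials, chosen so that
  -- E₂F₂₅G₆ and E₆F₂₅G₂ cancel.
  have h := add_mem (add_mem
    (Ideal.mul_mem_left _ (C ((d 0 - d 5) * (d 0 + d 4 + d 5) *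
      ((d 0 + d 1 + d 3) * (d 2 - d 5))) * X (.F (pair 1 4 (by decide)))) h₁)
    (Ideal.mul_mem_left _ (C ((d 0 + d 2 + d 5) * (d 3 + d 4 + d 5) *
      ((d 0 + d 1 + d 3) * (d 2 - d 5))) * X (.G 5)) h₂))
    (Ideal.mul_mem_left _ (C ((d 0 + d 1 + d 2) * (d 1 + d 3 + d 4) *
      ((d 0 - d 5) * (d 0 + d 4 + d 5))) * X (.E 5)) h₃)
  refine (congrArg (· ∈ trinomialIdeal d) ?_).mpr h
  simp only [hmon, trinomial, leadCoeff, map_mul, map_add, map_sub, map_neg]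
  ring

lemma coxWeight_monomials :
    coxWeight (.E 5) + coxWeight (.F (pair 4 5 (by decide))) + coxWeight (.G 5) = 1 ∧
    coxWeight (.F (pair 0 2 (by decide))) + coxWeight (.F (pair 3 4 (by decide))) +
      coxWeight (.F (pair 1 4 (by decide))) = 2 ∧
    coxWeight (.E 0) + coxWeight (.F (pair 0 4 (by decide))) + coxWeight (.G 5) = 2 ∧
    coxWeight (.E 5) + coxWeight (.F (pair 2 4 (by decide))) + coxWeight (.G 2) = 2 := by
  simp only [coxWeight_eq_natCast]
  norm_cast

/-- E₆F₅₆G₆ has weight 1 and the other three monomials of the cubic have weight 2. The polynomial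
version serves the initial ideals, the Laurent version serves Trop(J). -/
lemma exists_initialForm_eq {d : Params} (hd : leadCoeff d ≠ 0) :
    ∃ f ∈ trinomialIdeal d,
      initialForm coxWeight f = C (leadCoeff d) * monomialE6F56G6 ∧
      IsLaurentMonomial (laurentInitialForm coxWeight (toLaurent ℂ Line f)) := by
  classical
  obtain ⟨w₁, w₂, w₃, w₄⟩ := coxWeight_monomials
  obtain ⟨a, b, c, h⟩ := exists_cubic_mem_trinomialIdeal d
  refine ⟨_, h, ?_, ?_⟩
  · rw [initialForm_monomial_add _ hd]
    · simp only [monomialE6F56G6, X, C_apply, monomial_mul, mul_one, zero_add]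
    -- The coefficients a, b, c may vanish, so only membership in the support of the remainder is
    -- used.
    · intro β hβ
      rw [weight_triple, w₁]
      rw [mem_support_iff, coeff_add, coeff_add, coeff_monomial, coeff_monomial,
        coeff_monomial] at hβ
      split_ifs at hβ with h₁ h₂ h₃ h₃ h₂ h₃ h₃
      all_goals first
        | (rw [← h₁, weight_triple, w₂]; norm_num)
        | (rw [← h₂, weight_triple, w₃]; norm_num)
        | (rw [← h₃, weight_triple, w₄]; norm_num)
        | simp at hβ
  · have hmon : ∀ (u v x : Line) (e : ℂ), toLaurent ℂ Line (monomial (Finsupp.single u 1 +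
        Finsupp.single v 1 + Finsupp.single x 1) e) = AddMonoidAlgebra.single
          (Finsupp.single u 1 + Finsupp.single v 1 + Finsupp.single x 1) e := by
      intro u v x e
      have : (monomial (Finsupp.single u 1 + Finsupp.single v 1 + Finsupp.single x 1) e :
          MvPolynomial Line ℂ) = C e * X u * X v * X x := by
        simp only [X, C_apply, monomial_mul, mul_one, zero_add]
      simp only [this, map_mul, toLaurent_C, toLaurent_X, AddMonoidAlgebra.single_mul_single,
        mul_one, zero_add]
    have hw : ∀ u v x : Line, laurentWeight coxWeight (Finsupp.single u 1 + Finsupp.single v 1 +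
        Finsupp.single x 1) = coxWeight u + coxWeight v + coxWeight x := fun u v x => by
      simp only [laurentWeight_add, laurentWeight_single]
    simp only [map_add, hmon]
    rw [laurentInitialForm_single_add _ hd]
    · exact ⟨_, _, hd, rfl⟩
    · intro β hβ
      rw [hw, w₁]
      rw [Finsupp.mem_support_iff, AddMonoidAlgebra.coeff_add, AddMonoidAlgebra.coeff_add,
        AddMonoidAlgebra.coeff_single, AddMonoidAlgebra.coeff_single,
        AddMonoidAlgebra.coeff_single, Finsupp.add_apply, Finsupp.add_apply,
        Finsupp.single_apply, Finsupp.single_apply, Finsupp.single_apply] at hβ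
      split_ifs at hβ with h₁ h₂ h₃ h₃ h₂ h₃ h₃
      all_goals first
        | (rw [← h₁, hw, w₂]; norm_num)
        | (rw [← h₂, hw, w₃]; norm_num)
        | (rw [← h₃, hw, w₄]; norm_num)
        | simp at hβ

lemma monomial_mem_initialIdeal {d : Params} (hd : leadCoeff d ≠ 0)
    {I : Ideal (MvPolynomial Line ℂ)} (hI : trinomialIdeal d ≤ I) :
    monomialE6F56G6 ∈ initialIdeal coxWeight I := by
  obtain ⟨f, hf, hin, -⟩ := exists_initialForm_eq hd
  have h : C (leadCoeff d) * monomialE6F56G6 ∈ initialIdeal coxWeight I :=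
    Ideal.subset_span ⟨f, hI hf, hin⟩
  exact (Ideal.unit_mul_mem_iff_mem _ ((isUnit_iff_ne_zero.mpr hd).map C)).mp h

lemma span_laurentTrinomials (d : Params) :
    Ideal.span (laurentTrinomials d) = laurentCoxIdeal d := by
  rw [laurentTrinomials, laurentCoxIdeal, coxIdeal, map_toLaurent_saturation, trinomialIdeal,
    Ideal.map_span]

lemma coxWeight_notMem_Trop {d : Params} (hd : leadCoeff d ≠ 0) :
    coxWeight ∉ Trop (laurentCoxIdeal d : Set (Laurent ℂ Line)) := by
  obtain ⟨f, hf, -, hmon⟩ := exists_initialForm_eq hd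
  exact fun h => h _ (Ideal.mem_map_of_mem _ (le_saturation _ hf)) hmon

/-! ### The genericity condition -/

/-- The discriminant of the parameters: the product of the roots of `E₆` (with multiplicities) and
of `leadCoeff`. -/
def discriminant : MvPolynomial (Fin 6) ℂ :=
  (∏ i, ∏ j, if i = j then 1 else X i - X j) *
    (∏ i, ∏ j, ∏ k, if i ≠ j ∧ i ≠ k ∧ j ≠ k then X i + X j + X k else 1) *
    (∑ i, X i) * leadCoeff X

lemma eval_discriminant_ne_zero_iff (d : Params) :
    eval d discriminant ≠ 0 ↔ IsRegular d ∧ leadCoeff d ≠ 0 := by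
  have hlead : eval d (leadCoeff X) = leadCoeff d := by
    simp only [leadCoeff, map_add, map_sub, map_mul, eval_X]
  simp only [discriminant, map_mul, map_prod, map_sum, hlead, mul_ne_zero_iff,
    Finset.prod_ne_zero_iff, Finset.mem_univ, true_imp_iff, eval_X]
  refine and_congr_left fun _ => ⟨fun ⟨⟨h₁, h₂⟩, h₃⟩ => ⟨?_, ?_, h₃⟩, fun h => ⟨⟨?_, ?_⟩, h.sum_ne⟩⟩
  · intro i j hij
    simpa [hij] using h₁ i j
  · intro i j k hij hik hjk
    simpa [hij, hik, hjk] using h₂ i j k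
  · intro i j
    split_ifs with hij
    · simp
    · simpa using h.sub_ne i j hij
  · intro i j k
    split_ifs with hijk
    · simpa using h.add_ne i j k hijk.1 hijk.2.1 hijk.2.2
    · simp

lemma discriminant_ne_zero : discriminant ≠ 0 := by
  -- At d = (1, 2, 4, 8, 16, 32) the entries are distinct and positive, so no root vanishes;
  -- `leadCoeff` is evaluated directly.
  have h : eval (fun i : Fin 6 => ((2 ^ (i : ℕ) : ℕ) : ℂ)) discriminant ≠ 0 := by
    rw [eval_discriminant_ne_zero_iff]
    refine ⟨⟨fun i j hij => ?_, fun i j k _ _ _ => ?_, ?_⟩, ?_⟩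
    · rw [sub_ne_zero, Nat.cast_injective.ne_iff]
      exact fun h => hij (Fin.ext (Nat.pow_right_injective le_rfl h))
    · norm_cast
      positivity
    · norm_num [Fin.sum_univ_six]
    · norm_num [leadCoeff]
  rintro h₀
  simp [h₀] at h

end CubicCox

end

theorem theorem3p2 :
    ∃ P : MvPolynomial (Fin 6) ℂ, P ≠ 0 ∧ ∀ d : Fin 6 → ℂ, MvPolynomial.eval d P ≠ 0 →
      Ideal.span (CubicCox.laurentTrinomials d) = CubicCox.laurentCoxIdeal d ∧
      ¬ CubicCox.IsTropicalBasis (CubicCox.laurentTrinomials d) (CubicCox.laurentCoxIdeal d) ∧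
      CubicCox.coxWeight ∈ CubicCox.Trop (CubicCox.laurentTrinomials d) ∧
      CubicCox.coxWeight ∉
        CubicCox.Trop (CubicCox.laurentCoxIdeal d : Set (CubicCox.Laurent ℂ CubicCox.Line)) ∧
      CubicCox.monomialE6F56G6 ∈
        CubicCox.initialIdeal CubicCox.coxWeight (CubicCox.trinomialIdeal d) ∧
      CubicCox.monomialE6F56G6 ∈
        CubicCox.initialIdeal CubicCox.coxWeight (CubicCox.coxIdeal d) := by
  refine ⟨CubicCox.discriminant, CubicCox.discriminant_ne_zero, fun d hd => ?_⟩
  obtain ⟨hreg, hlead⟩ := (CubicCox.eval_discriminant_ne_zero_iff d).mp hd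
  have hmem := CubicCox.coxWeight_mem_Trop hreg
  have hnotMem := CubicCox.coxWeight_notMem_Trop hlead
  exact ⟨CubicCox.span_laurentTrinomials d, fun h => hnotMem (h.2 ▸ hmem), hmem, hnotMem,
    CubicCox.monomial_mem_initialIdeal hlead le_rfl,
    CubicCox.monomial_mem_initialIdeal hlead (CubicCox.le_saturation _)⟩
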